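/- Let $A,B\in\mathbb{Z}$ and let $E/\mathbb{Q}$ be the elliptic curve $y^2=x^3+Ax+B$, with discriminant $\Delta=-16(4A^3+27B^2)\neq 0$. Assume that this equation is quasi-minimal, i.e. for every prime $p\neq 2,3$ it is minimal at $p$: its discriminant has the smallest possible $p$-adic valuation among all $p$-integral Weierstrass equations of $E$. Assume moreover that $E(\mathbb{Q})$ contains a point of order $2$. Then the rank $r$ of $E(\mathbb{Q})$ satisfies $$r\le 2\,\omega(\Delta)+2,$$ where $\omega(m)$ denotes the number of distinct prime factors of the nonzero integer $m$. -/

import Mathlib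

/-- The short Weierstrass equation `y² = x³ + A x + B` with integral coefficients. -/
def shortCurve (A B : ℤ) : WeierstrassCurve ℤ := ⟨0, 0, 0, A, B⟩

/-- The discriminant (in the sense of Mathlib) of a short Weierstrass equation is the usual one. -/
theorem shortCurve_discr (A B : ℤ) :
    (shortCurve A B).Δ = -16 * (4 * A ^ 3 + 27 * B ^ 2) := by
  simp only [shortCurve, WeierstrassCurve.Δ, WeierstrassCurve.b₂, WeierstrassCurve.b₄,
    WeierstrassCurve.b₆, WeierstrassCurve.b₈]
  ring

/-- An integral Weierstrass equation is quasi-minimal if it is minimal (over `ℤ_p`, as an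
equation over `ℚ_p`) at every prime `p` other than possibly `2` and `3`. -/
def IsQuasiMinimal (W : WeierstrassCurve ℤ) : Prop :=
  ∀ (p : ℕ) [Fact p.Prime], p ≠ 2 → p ≠ 3 →
    WeierstrassCurve.IsMinimal ℤ_[p] (W.baseChange ℚ_[p])

/-- The group of rational points of an integral Weierstrass equation (the nonsingular affine
solutions over `ℚ`, and the point at infinity, which is zero). -/
abbrev RatPoint (W : WeierstrassCurve ℤ) : Type :=
  (W.baseChange ℚ).toAffine.Point

/-- `ω(m)`: the number of distinct prime factors of the integer `m`. -/
def numPrimeFactors (m : ℤ) : ℕ := ArithmeticFunction.cardDistinctFactors m.natAbs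

/-! The proof is descent by a `2`-isogeny. Moving the rational `2`-torsion point `T = (t, 0)` to the
origin gives `E : y² = x(x² + ax + b)`, with `a`, `b` integers since `t` is a rational root of a
monic integral cubic. The curve `E' : y² = x(x² - 2ax + a² - 4b)` has a `2`-isogeny `ψ : E' → E`.

On each curve the `x`-coordinate relative to the `2`-torsion point, taken modulo squares, is a
homomorphism (`isSquare_rootDiff_mul`). A point of `E` with trivial class lies in the image of `ψ`
(`mem_range_isogeny`), and `ψ` sends a point of `E'` with trivial class into `2E(ℚ)`
(`isogeny_mem_range_nsmul`). Hence `|E(ℚ)/2E(ℚ)|` is at most the product of the sizes of the two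
groups of classes. A class has even valuation away from the primes dividing `b`, respectively `a² -
4b`, so it is determined by a sign and by parities at the primes dividing `Δ = 16b²(a² - 4b)`. Each
group thus has order at most `2^(ω(Δ) + 1)`.

Finite index of `2E(ℚ)` together with the approximate parallelogram law for the naive height makes
`E(ℚ)` finitely generated, and then `2^r ≤ |E(ℚ)/2E(ℚ)|`. -/

namespace WeierstrassCurve.Affine.Point

/-! ### Collinearity as a criterion for `P + Q + R = 0` -/

variable {K : Type*} [Field K] [DecidableEq K] {W : WeierstrassCurve K} [W.IsCharNeTwoNF]

/-- Vieta's formulas for the cubic obtained by substituting the line `y = lx + n` into the curve.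
They treat chords and tangents uniformly, so later arguments need no case distinction on coinciding
points. -/
theorem exists_line_of_add_add_eq_zero {x₁ y₁ x₂ y₂ x₃ y₃ : K}
    {h₁ : W.toAffine.Nonsingular x₁ y₁} {h₂ : W.toAffine.Nonsingular x₂ y₂}
    {h₃ : W.toAffine.Nonsingular x₃ y₃} (h : some x₁ y₁ h₁ + some x₂ y₂ h₂ + some x₃ y₃ h₃ = 0) :
    ∃ l n : K, y₁ = l * x₁ + n ∧ y₂ = l * x₂ + n ∧ y₃ = l * x₃ + n ∧
      x₁ + x₂ + x₃ = l ^ 2 - W.a₂ ∧ x₁ * x₂ + x₁ * x₃ + x₂ * x₃ = W.a₄ - 2 * l * n ∧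
      x₁ * x₂ * x₃ = n ^ 2 - W.a₆ := by
  have h' := eq_neg_of_add_eq_zero_left h
  have hxy : ¬(x₁ = x₂ ∧ y₁ = W.toAffine.negY x₂ y₂) := by
    rintro ⟨hx, hy⟩
    rw [add_of_Y_eq hx hy, eq_comm, neg_eq_zero] at h'
    exact some_ne_zero h₃ h'
  rw [add_some hxy, neg_some] at h'
  have ha₁ : W.a₁ = 0 := W.a₁_of_isCharNeTwoNF
  have ha₃ : W.a₃ = 0 := W.a₃_of_isCharNeTwoNF
  have hp := addPolynomial_slope h₁.1 h₂.1 hxy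
  have hl : W.toAffine.slope x₁ x₂ y₁ y₂ * (x₁ - x₂) = y₁ - y₂ := by
    by_cases hx : x₁ = x₂
    · rw [Y_eq_of_Y_ne h₁.1 h₂.1 hx fun hy ↦ hxy ⟨hx, hy⟩, hx]; ring
    · rw [slope_of_X_ne hx, div_mul_cancel₀ _ (sub_ne_zero.mpr hx)]
  obtain ⟨hX, hY⟩ := (some.injEq ..).mp h'
  generalize W.toAffine.slope x₁ x₂ y₁ y₂ = l at hX hY hp hl
  rw [hX] at hp
  -- The value at `0` gives the product of the roots; the value at `1`, combined with the sum of the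
  -- roots, gives the second symmetric function.
  have e₀ := congrArg (Polynomial.eval 0) hp
  have e₁ := congrArg (Polynomial.eval 1) hp
  simp only [addPolynomial, linePolynomial, polynomial] at e₀ e₁
  simp [ha₁, ha₃] at e₀ e₁
  rw [addY, hX, negAddY, hX] at hY
  simp only [addX, negY, ha₁, ha₃] at hX hY
  have s : x₁ + x₂ + x₃ = l ^ 2 - W.a₂ := by linear_combination -hX
  refine ⟨l, y₁ - l * x₁, by ring, by linear_combination hl, by linear_combination hY, s, ?_, ?_⟩
  · linear_combination e₁ - e₀ + s
  · linear_combination -e₀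

theorem add_add_eq_zero_of_line (h2 : (2 : K) ≠ 0) {x₁ y₁ x₂ y₂ x₃ y₃ l n : K}
    (h₁ : W.toAffine.Nonsingular x₁ y₁) (h₂ : W.toAffine.Nonsingular x₂ y₂)
    (h₃ : W.toAffine.Nonsingular x₃ y₃) (hy₁ : y₁ = l * x₁ + n) (hy₂ : y₂ = l * x₂ + n)
    (hy₃ : y₃ = l * x₃ + n) (s₁ : x₁ + x₂ + x₃ = l ^ 2 - W.a₂)
    (s₂ : x₁ * x₂ + x₁ * x₃ + x₂ * x₃ = W.a₄ - 2 * l * n) :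
    some x₁ y₁ h₁ + some x₂ y₂ h₂ + some x₃ y₃ h₃ = 0 := by
  have ha₁ : W.a₁ = 0 := W.a₁_of_isCharNeTwoNF
  have ha₃ : W.a₃ = 0 := W.a₃_of_isCharNeTwoNF
  -- At a double root, Vieta's relations force the line to be tangent.
  have d : x₁ = x₂ → 2 * l * y₁ = 3 * x₁ ^ 2 + 2 * W.a₂ * x₁ + W.a₄ := by
    rintro rfl
    linear_combination 2 * l * hy₁ + s₂ - 2 * x₁ * s₁
  have hxy : ¬(x₁ = x₂ ∧ y₁ = W.toAffine.negY x₂ y₂) := by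
    rintro ⟨hx, hy⟩
    subst hx
    have hy0 : y₁ = 0 := by
      have : 2 * y₁ = 0 := by
        simp only [negY, ha₁, ha₃] at hy
        linear_combination hy + hy₁ - hy₂
      simpa [h2] using this
    have := ((nonsingular_iff' ..).mp h₁).2
    simp only [ha₁, ha₃, ← d rfl, hy0] at this
    simp at this
  have hl : W.toAffine.slope x₁ x₂ y₁ y₂ = l := by
    by_cases hx : x₁ = x₂
    · have hy : y₁ ≠ W.toAffine.negY x₂ y₂ := fun hy ↦ hxy ⟨hx, hy⟩
      have hyy : y₁ = y₂ := by rw [hy₁, hy₂, hx]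
      rw [slope_of_Y_ne hx hy]
      rw [← hx, ← hyy] at hy
      rw [div_eq_iff (sub_ne_zero.mpr hy)]
      simp only [negY, ha₁, ha₃]
      linear_combination -d hx
    · rw [slope_of_X_ne hx, div_eq_iff (sub_ne_zero.mpr hx)]
      linear_combination hy₁ - hy₂
  refine add_eq_zero_iff_eq_neg.mpr ?_
  rw [add_some hxy, neg_some, some.injEq]
  have hX : W.toAffine.addX x₁ x₂ (W.toAffine.slope x₁ x₂ y₁ y₂) = x₃ := by
    rw [hl, addX, ha₁]
    linear_combination -s₁
  refine ⟨hX, ?_⟩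
  rw [addY, hX, negAddY, hX, hl]
  congr 1
  linear_combination hy₁ - hy₃

theorem eq_sq_of_equation {x y : K} (h : W.toAffine.Equation x y) :
    y ^ 2 = x ^ 3 + W.a₂ * x ^ 2 + W.a₄ * x + W.a₆ := by
  have := (equation_iff ..).mp h
  simpa using this

/-- A map that is compatible with negation and with collinearity is additive. -/
def homOfAddAddEqZero {G H : Type*} [AddCommGroup G] [AddCommGroup H] (f : G → H)
    (neg : ∀ P, f (-P) = -f P) (add : ∀ P Q R, P + Q + R = 0 → f P + f Q + f R = 0) :
    G →+ H :=
  AddMonoidHom.mk' f fun P Q ↦ by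
    have := add P Q (-(P + Q)) (by abel)
    rw [neg] at this
    exact (add_neg_eq_zero.mp this).symm

/-! ### The descent map modulo squares -/

/-- The `x`-coordinate relative to a root `t` of the cubic, with the value at the root itself
replaced by the derivative of the cubic. -/
def rootDiff (t : K) : W.toAffine.Point → K
  | 0 => 1
  | some x _ _ => if x = t then 3 * t ^ 2 + 2 * W.a₂ * t + W.a₄ else x - t

variable {t : K}

@[simp]
theorem rootDiff_zero : rootDiff t (0 : W.toAffine.Point) = 1 := rfl

theorem rootDiff_some {x y : K} (h : W.toAffine.Nonsingular x y) :
    rootDiff t (some x y h) = if x = t then 3 * t ^ 2 + 2 * W.a₂ * t + W.a₄ else x - t := rfl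

theorem rootDiff_neg (P : W.toAffine.Point) : rootDiff t (-P) = rootDiff t P := by
  cases P <;> rfl

theorem derivative_ne_zero_of_root [W.IsElliptic] (ht : W.toAffine.Equation t 0) :
    3 * t ^ 2 + 2 * W.a₂ * t + W.a₄ ≠ 0 := by
  have := ((nonsingular_iff' ..).mp (equation_iff_nonsingular.mp ht)).2
  have ha₁ : W.toAffine.a₁ = 0 := W.a₁_of_isCharNeTwoNF
  have ha₃ : W.toAffine.a₃ = 0 := W.a₃_of_isCharNeTwoNF
  simpa only [ha₁, ha₃, zero_mul, mul_zero, zero_sub, add_zero, ne_eq, neg_eq_zero,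
    not_true_eq_false, or_false] using this

theorem rootDiff_ne_zero [W.IsElliptic] (ht : W.toAffine.Equation t 0) (P : W.toAffine.Point) :
    rootDiff t P ≠ 0 := by
  rcases P with _ | ⟨x, y, h⟩
  · exact one_ne_zero
  · rw [rootDiff_some]
    split_ifs with hx
    · exact derivative_ne_zero_of_root ht
    · exact sub_ne_zero.mpr hx

theorem eq_zero_of_root (ht : W.toAffine.Equation t 0) {y : K} (h : W.toAffine.Equation t y) :
    y = 0 := by
  have h₁ := eq_sq_of_equation h
  rw [← eq_sq_of_equation ht] at h₁
  simpa using h₁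

/-- Comparing cubic and line at `x = t` gives `∏ (xᵢ - t) = (lt + n)²`. If one of the points is `(t,
0)`, this only says `0 = 0`; but then the derivative of the cubic at `t` equals the product of the
other two factors, so the value chosen there again makes the product a square. Since `t` is a simple
root, at most one of the points is `(t, 0)`. -/
theorem isSquare_rootDiff_mul [W.IsElliptic] (ht : W.toAffine.Equation t 0)
    (P Q R : W.toAffine.Point) (h : P + Q + R = 0) :
    IsSquare (rootDiff t P * rootDiff t Q * rootDiff t R) := by
  have opp (P Q : W.toAffine.Point) (h : P + Q = 0) : IsSquare (rootDiff t P * rootDiff t Q) := by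
    rw [eq_neg_of_add_eq_zero_left h, rootDiff_neg]
    exact ⟨_, rfl⟩
  have e₀ := eq_sq_of_equation ht
  rcases P with _ | ⟨x₁, y₁, h₁⟩
  · rw [← zero_def, zero_add] at h
    simpa [← zero_def] using opp _ _ h
  rcases Q with _ | ⟨x₂, y₂, h₂⟩
  · rw [← zero_def, add_zero] at h
    simpa [← zero_def] using opp _ _ h
  rcases R with _ | ⟨x₃, y₃, h₃⟩
  · rw [← zero_def, add_zero] at h
    simpa [← zero_def] using opp _ _ h
  obtain ⟨l, n, r₁, r₂, r₃, s₁, s₂, s₃⟩ := exists_line_of_add_add_eq_zero h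
  have key : (x₁ - t) * (x₂ - t) * (x₃ - t) = (l * t + n) ^ 2 := by
    linear_combination s₃ - t * s₂ + t ^ 2 * s₁ + e₀
  have root {x y : K} (hx : x = t) (hn : W.toAffine.Nonsingular x y) (hy : y = l * x + n) :
      n = -l * t := by
    subst hx
    linear_combination -hy + eq_zero_of_root ht hn.1
  have hb := derivative_ne_zero_of_root ht
  simp only [rootDiff_some]
  by_cases hx₁ : x₁ = t
  · have hb' : 3 * t ^ 2 + 2 * W.a₂ * t + W.a₄ = (x₂ - t) * (x₃ - t) := by
      have hn := root hx₁ h₁ r₁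
      subst hx₁
      linear_combination -s₂ + 2 * x₁ * s₁ + 2 * l * hn
    rw [hb'] at hb ⊢
    rw [if_pos hx₁, if_neg (by grind), if_neg (by grind)]
    exact ⟨(x₂ - t) * (x₃ - t), by ring⟩
  by_cases hx₂ : x₂ = t
  · have hb' : 3 * t ^ 2 + 2 * W.a₂ * t + W.a₄ = (x₁ - t) * (x₃ - t) := by
      have hn := root hx₂ h₂ r₂
      subst hx₂
      linear_combination -s₂ + 2 * x₂ * s₁ + 2 * l * hn
    rw [hb'] at hb ⊢
    rw [if_pos hx₂, if_neg hx₁, if_neg (by grind)]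
    exact ⟨(x₁ - t) * (x₃ - t), by ring⟩
  by_cases hx₃ : x₃ = t
  · have hb' : 3 * t ^ 2 + 2 * W.a₂ * t + W.a₄ = (x₁ - t) * (x₂ - t) := by
      have hn := root hx₃ h₃ r₃
      subst hx₃
      linear_combination -s₂ + 2 * x₃ * s₁ + 2 * l * hn
    rw [hb', if_pos hx₃, if_neg hx₁, if_neg hx₂]
    exact ⟨(x₁ - t) * (x₂ - t), by ring⟩
  rw [if_neg hx₁, if_neg hx₂, if_neg hx₃, key]
  exact ⟨l * t + n, by ring⟩

end WeierstrassCurve.Affine.Point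

/-! ### The isogenous curve and the `2`-isogeny -/

namespace WeierstrassCurve

variable {K : Type*} [Field K]

/-- The curve `y² = x (x² - 2 a x + a² - 4 b)`, where `a` and `b` are the coefficients of
`(x - t) ((x - t)² + a (x - t) + b)`, the cubic of `W` at its root `t`. -/
def isogenous (W : WeierstrassCurve K) (t : K) : WeierstrassCurve K :=
  ⟨0, -2 * (W.a₂ + 3 * t), 0, (W.a₂ + 3 * t) ^ 2 - 4 * (3 * t ^ 2 + 2 * W.a₂ * t + W.a₄), 0⟩

instance (W : WeierstrassCurve K) (t : K) : (W.isogenous t).IsCharNeTwoNF := ⟨rfl, rfl⟩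

theorem isogenous_root (W : WeierstrassCurve K) (t : K) :
    (W.isogenous t).toAffine.Equation 0 0 := by
  simp [isogenous]

variable {W : WeierstrassCurve K} [W.IsCharNeTwoNF] {t : K}

theorem Δ_of_root (ht : W.toAffine.Equation t 0) :
    W.Δ = 16 * (3 * t ^ 2 + 2 * W.a₂ * t + W.a₄) ^ 2 *
      ((W.a₂ + 3 * t) ^ 2 - 4 * (3 * t ^ 2 + 2 * W.a₂ * t + W.a₄)) := by
  have ha₁ : W.a₁ = 0 := W.a₁_of_isCharNeTwoNF
  have ha₃ : W.a₃ = 0 := W.a₃_of_isCharNeTwoNF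
  have h : W.a₆ = -(t ^ 3 + W.a₂ * t ^ 2 + W.a₄ * t) := by
    have := (Affine.equation_iff ..).mp ht
    linear_combination -this
  simp only [Δ, b₂, b₄, b₆, b₈, ha₁, ha₃, h]
  ring

variable [DecidableEq K]

theorem isogenous_a₄_ne_zero [W.IsElliptic] (ht : W.toAffine.Equation t 0) :
    (W.a₂ + 3 * t) ^ 2 - 4 * (3 * t ^ 2 + 2 * W.a₂ * t + W.a₄) ≠ 0 := by
  intro h
  have h' := Δ_of_root ht
  rw [h, mul_zero] at h'
  exact W.isUnit_Δ.ne_zero h'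

theorem isElliptic_isogenous [NeZero (2 : K)] [W.IsElliptic] (ht : W.toAffine.Equation t 0) :
    (W.isogenous t).IsElliptic := by
  refine ⟨isUnit_iff_ne_zero.mpr ?_⟩
  have h₁ := Affine.Point.derivative_ne_zero_of_root ht
  have h₂ := isogenous_a₄_ne_zero ht
  rw [Δ_of_root (isogenous_root W t)]
  have h2 : (2 : K) ≠ 0 := two_ne_zero
  have : (16 * (W.isogenous t).a₄ ^ 2 *
      ((W.isogenous t).a₂ ^ 2 - 4 * (W.isogenous t).a₄)) ≠ 0 := by
    -- The construction is an involution up to scaling: `a'² - 4b' = 16b`.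
    rw [show (W.isogenous t).a₂ ^ 2 - 4 * (W.isogenous t).a₄ =
      2 ^ 4 * (3 * t ^ 2 + 2 * W.a₂ * t + W.a₄) by simp only [isogenous]; ring,
      show (16 : K) = 2 ^ 4 by norm_num]
    exact mul_ne_zero (mul_ne_zero (pow_ne_zero _ h2) (pow_ne_zero _ h₂))
      (mul_ne_zero (pow_ne_zero _ h2) h₁)
  simpa using this

namespace Affine.Point

variable [NeZero (2 : K)] [W.IsElliptic]

/-- Applying the construction twice gives `y² = x(x² + 4ax + 16b)`. The factors `4` and `8` rescale
this curve back to `W`, and adding `t` undoes the translation. -/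
theorem isogeny_nonsingular (ht : W.toAffine.Equation t 0) {x y : K}
    (h : (W.isogenous t).toAffine.Equation x y) (hx : x ≠ 0) :
    W.toAffine.Nonsingular (t + y ^ 2 / (4 * x ^ 2))
      (y * ((W.isogenous t).a₄ - x ^ 2) / (8 * x ^ 2)) := by
  have h2 : (2 : K) ≠ 0 := two_ne_zero
  have h4 : (4 : K) ≠ 0 := by rw [show (4 : K) = 2 ^ 2 by norm_num]; exact pow_ne_zero _ h2
  have h8 : (8 : K) ≠ 0 := by rw [show (8 : K) = 2 ^ 3 by norm_num]; exact pow_ne_zero _ h2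
  refine equation_iff_nonsingular.mp ((equation_iff ..).mpr ?_)
  have e := eq_sq_of_equation h
  have e₀ := eq_sq_of_equation ht
  simp only [isogenous] at e ⊢
  have ha₁ : W.toAffine.a₁ = 0 := W.a₁_of_isCharNeTwoNF
  have ha₃ : W.toAffine.a₃ = 0 := W.a₃_of_isCharNeTwoNF
  simp only [ha₁, ha₃, zero_mul, add_zero]
  have e₁ : W.a₆ = -(t ^ 3 + W.a₂ * t ^ 2 + W.a₄ * t) := by linear_combination -e₀
  rw [show W.toAffine.a₆ = W.a₆ from rfl, e₁]
  field_simp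
  grind

/-- The map underlying the `2`-isogeny from `W.isogenous t` to `W`. -/
noncomputable def isogenyFun (ht : W.toAffine.Equation t 0) :
    (W.isogenous t).toAffine.Point → W.toAffine.Point
  | 0 => 0
  | some x y h => if hx : x = 0 then 0 else
      some (t + y ^ 2 / (4 * x ^ 2)) (y * ((W.isogenous t).a₄ - x ^ 2) / (8 * x ^ 2))
        (isogeny_nonsingular ht h.1 hx)

/-- The isogeny maps the points of the curve on `y = lx + n` to points of a single line, whose slope
and intercept depend only on `l`, `n` and the curve. After clearing denominators this is `nl` times
the equation of the curve. -/
theorem isogeny_line {a b l n x y t : K} (hx : x ≠ 0) (hn : n ≠ 0) (hy : y = l * x + n)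
    (he : y ^ 2 = x ^ 3 + a * x ^ 2 + b * x) :
    y * (b - x ^ 2) / (8 * x ^ 2) = -(l * n - b) / (2 * n) * (t + y ^ 2 / (4 * x ^ 2)) +
      (-(n ^ 2 - a * n * l + b * l ^ 2) / (8 * n) - -(l * n - b) / (2 * n) * t) := by
  have h2 : (2 : K) ≠ 0 := two_ne_zero
  have h : n * y * (b - x ^ 2) =
      -(l * n - b) * y ^ 2 - (n ^ 2 - a * n * l + b * l ^ 2) * x ^ 2 := by
    subst hy
    linear_combination n * l * he
  rw [show (4 : K) = 2 ^ 2 by norm_num, show (8 : K) = 2 ^ 3 by norm_num]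
  field_simp
  linear_combination h

/-- This and `isogeny_sum_mul` are the Vieta relations for the image line. The coefficients of the
curves are expressed through `xᵢ`, `l`, `n`, `t`; the one remaining relation `x₁x₂x₃ = n²`
eliminates `x₃`. -/
theorem isogeny_sum {l n x₁ x₂ x₃ t : K} (h₁ : x₁ ≠ 0) (h₂ : x₂ ≠ 0) (hn : n ≠ 0)
    (h : x₁ * x₂ * x₃ = n ^ 2) :
    t + (l * x₁ + n) ^ 2 / (4 * x₁ ^ 2) + (t + (l * x₂ + n) ^ 2 / (4 * x₂ ^ 2)) +
      (t + (l * x₃ + n) ^ 2 / (4 * x₃ ^ 2)) =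
      (-(l * n - (x₁ * x₂ + x₁ * x₃ + x₂ * x₃ + 2 * l * n)) / (2 * n)) ^ 2 -
        ((x₁ + x₂ + x₃ - l ^ 2) / 2 - 3 * t) := by
  have h2 : (2 : K) ≠ 0 := two_ne_zero
  have hx : x₃ = n ^ 2 / (x₁ * x₂) := by field_simp; linear_combination h
  rw [show (4 : K) = 2 ^ 2 by norm_num, hx]
  field_simp
  ring

theorem isogeny_sum_mul {l n x₁ x₂ x₃ t : K} (h₁ : x₁ ≠ 0) (h₂ : x₂ ≠ 0) (hn : n ≠ 0)
    (h : x₁ * x₂ * x₃ = n ^ 2) :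
    (t + (l * x₁ + n) ^ 2 / (4 * x₁ ^ 2)) * (t + (l * x₂ + n) ^ 2 / (4 * x₂ ^ 2)) +
      (t + (l * x₁ + n) ^ 2 / (4 * x₁ ^ 2)) * (t + (l * x₃ + n) ^ 2 / (4 * x₃ ^ 2)) +
      (t + (l * x₂ + n) ^ 2 / (4 * x₂ ^ 2)) * (t + (l * x₃ + n) ^ 2 / (4 * x₃ ^ 2)) =
      (((x₁ + x₂ + x₃ - l ^ 2) / 2 - 3 * t + 3 * t) ^ 2 -
        (x₁ * x₂ + x₁ * x₃ + x₂ * x₃ + 2 * l * n)) / 4 - 3 * t ^ 2 -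
        2 * ((x₁ + x₂ + x₃ - l ^ 2) / 2 - 3 * t) * t -
      2 * (-(l * n - (x₁ * x₂ + x₁ * x₃ + x₂ * x₃ + 2 * l * n)) / (2 * n)) *
        (-(n ^ 2 - (l ^ 2 - (x₁ + x₂ + x₃)) * n * l +
          (x₁ * x₂ + x₁ * x₃ + x₂ * x₃ + 2 * l * n) * l ^ 2) / (8 * n) -
          -(l * n - (x₁ * x₂ + x₁ * x₃ + x₂ * x₃ + 2 * l * n)) / (2 * n) * t) := by
  have h2 : (2 : K) ≠ 0 := two_ne_zero
  have hx : x₃ = n ^ 2 / (x₁ * x₂) := by field_simp; linear_combination h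
  rw [show (4 : K) = 2 ^ 2 by norm_num, show (8 : K) = 2 ^ 3 by norm_num, hx]
  field_simp
  ring

variable (ht : W.toAffine.Equation t 0)

theorem isogenyFun_zero : isogenyFun ht 0 = 0 := rfl

theorem isogenyFun_some_of_eq {x y : K} (h : (W.isogenous t).toAffine.Nonsingular x y)
    (hx : x = 0) : isogenyFun ht (some x y h) = 0 :=
  dif_pos hx

theorem isogenyFun_some_of_ne {x y : K} (h : (W.isogenous t).toAffine.Nonsingular x y)
    (hx : x ≠ 0) : isogenyFun ht (some x y h) =
      some (t + y ^ 2 / (4 * x ^ 2)) (y * ((W.isogenous t).a₄ - x ^ 2) / (8 * x ^ 2))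
        (isogeny_nonsingular ht h.1 hx) :=
  dif_neg hx

theorem isogenyFun_neg (P : (W.isogenous t).toAffine.Point) :
    isogenyFun ht (-P) = -isogenyFun ht P := by
  rcases P with _ | ⟨x, y, h⟩
  · rfl
  · rw [neg_some]
    by_cases hx : x = 0
    · rw [isogenyFun_some_of_eq ht _ hx, isogenyFun_some_of_eq ht _ hx, neg_zero]
    · rw [isogenyFun_some_of_ne ht _ hx, isogenyFun_some_of_ne ht _ hx, neg_some, some.injEq]
      constructor
      · simp
      · simp
        ring

/-- Translation by the kernel does not change the value of the isogeny. -/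
theorem isogenyFun_add_of_eq_zero {x y : K} (h : (W.isogenous t).toAffine.Nonsingular x y)
    (hx : x = 0) (Q R : (W.isogenous t).toAffine.Point) (hs : some x y h + Q + R = 0) :
    isogenyFun ht Q + isogenyFun ht R = 0 := by
  subst hx
  rcases Q with _ | ⟨x₂, y₂, h₂⟩
  · rw [← zero_def, add_zero] at hs
    rw [← neg_eq_of_add_eq_zero_right hs, isogenyFun_neg, isogenyFun_some_of_eq ht _ rfl]
    simp [← zero_def, isogenyFun_zero]
  rcases R with _ | ⟨x₃, y₃, h₃⟩
  · rw [← zero_def, add_zero] at hs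
    rw [← neg_eq_of_add_eq_zero_right hs, isogenyFun_neg, isogenyFun_some_of_eq ht _ rfl]
    simp [← zero_def, isogenyFun_zero]
  obtain ⟨l, n, r₁, r₂, r₃, s₁, s₂, s₃⟩ := exists_line_of_add_add_eq_zero hs
  have hb := isogenous_a₄_ne_zero ht
  have hy : y = 0 := eq_zero_of_root (isogenous_root W t) h.1
  have hn : n = 0 := by linear_combination hy - r₁
  -- A line through `(0, 0)` has `n = 0`, so translation by `(0, 0)` sends `x` to `b'/x` up to the
  -- sign of the point.
  have hb' : x₂ * x₃ = (W.isogenous t).a₄ := by linear_combination s₂ - 2 * l * hn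
  have hb'' : x₂ * x₃ ≠ 0 := by rw [hb']; exact hb
  have hx₂ := left_ne_zero_of_mul hb''
  have hx₃ := right_ne_zero_of_mul hb''
  rw [isogenyFun_some_of_ne ht _ hx₂, isogenyFun_some_of_ne ht _ hx₃]
  have ha₁ : W.toAffine.a₁ = 0 := W.a₁_of_isCharNeTwoNF
  have ha₃ : W.toAffine.a₃ = 0 := W.a₃_of_isCharNeTwoNF
  refine add_of_Y_eq ?_ ?_
  · rw [r₂, r₃, hn]
    field_simp
    ring
  · simp only [negY, ha₁, ha₃]
    rw [r₂, r₃, hn, ← hb']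
    field_simp
    ring

theorem isogenyFun_add (P Q R : (W.isogenous t).toAffine.Point) (hs : P + Q + R = 0) :
    isogenyFun ht P + isogenyFun ht Q + isogenyFun ht R = 0 := by
  have h2 : (2 : K) ≠ 0 := two_ne_zero
  have h4 : (4 : K) ≠ 0 := by rw [show (4 : K) = 2 ^ 2 by norm_num]; exact pow_ne_zero _ h2
  have h8 : (8 : K) ≠ 0 := by rw [show (8 : K) = 2 ^ 3 by norm_num]; exact pow_ne_zero _ h2
  have opp (P Q : (W.isogenous t).toAffine.Point) (h : P + Q = 0) :
      isogenyFun ht P + isogenyFun ht Q = 0 := by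
    rw [eq_neg_of_add_eq_zero_left h, isogenyFun_neg, neg_add_cancel]
  rcases P with _ | ⟨x₁, y₁, h₁⟩
  · rw [← zero_def, zero_add] at hs
    rw [← zero_def, isogenyFun_zero, zero_add, opp _ _ hs]
  rcases Q with _ | ⟨x₂, y₂, h₂⟩
  · rw [← zero_def, add_zero] at hs
    rw [← zero_def, isogenyFun_zero, add_zero, opp _ _ hs]
  rcases R with _ | ⟨x₃, y₃, h₃⟩
  · rw [← zero_def, add_zero] at hs
    rw [← zero_def, isogenyFun_zero, add_zero, opp _ _ hs]
  by_cases hx₁ : x₁ = 0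
  · rw [isogenyFun_some_of_eq ht _ hx₁, zero_add]
    exact isogenyFun_add_of_eq_zero ht _ hx₁ _ _ hs
  by_cases hx₂ : x₂ = 0
  · rw [isogenyFun_some_of_eq ht _ hx₂, add_zero]
    exact isogenyFun_add_of_eq_zero ht _ hx₂ _ _ (by rw [← hs]; abel)
  by_cases hx₃ : x₃ = 0
  · rw [isogenyFun_some_of_eq ht _ hx₃, add_zero]
    exact isogenyFun_add_of_eq_zero ht _ hx₃ _ _ (by rw [← hs]; abel)
  obtain ⟨l, n, r₁, r₂, r₃, s₁, s₂, s₃⟩ := exists_line_of_add_add_eq_zero hs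
  rw [isogenyFun_some_of_ne ht _ hx₁, isogenyFun_some_of_ne ht _ hx₂,
    isogenyFun_some_of_ne ht _ hx₃]
  have s₃' : x₁ * x₂ * x₃ = n ^ 2 := by rw [s₃]; simp [isogenous]
  have hn : n ≠ 0 := by
    rintro rfl
    simp_all
  have hb : (W.isogenous t).a₄ = x₁ * x₂ + x₁ * x₃ + x₂ * x₃ + 2 * l * n := by
    linear_combination -s₂
  have hx : x₃ = n ^ 2 / (x₁ * x₂) := by field_simp; linear_combination s₃'
  have ha : -2 * (W.a₂ + 3 * t) = l ^ 2 - (x₁ + x₂ + x₃) := by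
    simp only [isogenous] at s₁
    linear_combination s₁
  have hb₂ : (W.isogenous t).a₄ = (W.a₂ + 3 * t) ^ 2 - 4 * (3 * t ^ 2 + 2 * W.a₂ * t + W.a₄) := rfl
  have ha' : W.a₂ = (x₁ + x₂ + x₃ - l ^ 2) / 2 - 3 * t := by
    field_simp
    linear_combination -ha
  have hb' : W.a₄ = ((W.a₂ + 3 * t) ^ 2 - (W.isogenous t).a₄) / 4 - 3 * t ^ 2 - 2 * W.a₂ * t := by
    field_simp
    linear_combination hb₂
  have e (x y : K) (h : (W.isogenous t).toAffine.Equation x y) : y ^ 2 = x ^ 3 +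
      (l ^ 2 - (x₁ + x₂ + x₃)) * x ^ 2 + (W.isogenous t).a₄ * x := by
    have := eq_sq_of_equation h
    rw [← ha, this]
    simp [isogenous]
  refine add_add_eq_zero_of_line h2 _ _ _ (isogeny_line hx₁ hn r₁ (e _ _ h₁.1))
    (isogeny_line hx₂ hn r₂ (e _ _ h₂.1)) (isogeny_line hx₃ hn r₃ (e _ _ h₃.1)) ?_ ?_
  · rw [ha', hb, r₁, r₂, r₃]
    exact isogeny_sum hx₁ hx₂ hn s₃'
  · rw [hb', ha', hb, r₁, r₂, r₃]
    exact isogeny_sum_mul hx₁ hx₂ hn s₃'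

/-- The `2`-isogeny from `W.isogenous t` to `W`. -/
noncomputable def isogeny : (W.isogenous t).toAffine.Point →+ W.toAffine.Point :=
  homOfAddAddEqZero (isogenyFun ht) (isogenyFun_neg ht) (isogenyFun_add ht)

theorem isogeny_apply (P : (W.isogenous t).toAffine.Point) : isogeny ht P = isogenyFun ht P := rfl

/-! ### Trivial classes: preimages under the isogeny, and halves -/

theorem mem_range_isogeny (P : W.toAffine.Point) (hP : IsSquare (rootDiff t P)) :
    P ∈ (isogeny ht).range := by
  have h2 : (2 : K) ≠ 0 := two_ne_zero
  have := isElliptic_isogenous ht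
  have hb' := isogenous_a₄_ne_zero ht
  have e₀ := eq_sq_of_equation ht
  rcases P with _ | ⟨x, y, h⟩
  · exact zero_mem _
  have e := eq_sq_of_equation h.1
  have eqn {u v : K} (huv : v ^ 2 = u ^ 3 - 2 * (W.a₂ + 3 * t) * u ^ 2 +
      ((W.a₂ + 3 * t) ^ 2 - 4 * (3 * t ^ 2 + 2 * W.a₂ * t + W.a₄)) * u) :
      (W.isogenous t).toAffine.Equation u v := by
    rw [equation_iff]
    simp only [isogenous]
    linear_combination huv
  obtain ⟨w, hw⟩ := hP
  rw [rootDiff_some] at hw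
  split_ifs at hw with hx
  · subst hx
    -- Here `P = T` and `b = w²`, so `x² - 2ax + a² - 4b` has the roots `a ± 2w`; the preimage is
    -- the `2`-torsion point at one of them.
    have hu : (W.a₂ + 3 * x + 2 * w) * (W.a₂ + 3 * x - 2 * w) ≠ 0 := by
      convert hb' using 1
      rw [hw]
      ring
    have hu := left_ne_zero_of_mul hu
    refine ⟨some (W.a₂ + 3 * x + 2 * w) 0 (equation_iff_nonsingular.mp (eqn ?_)), ?_⟩
    · rw [hw]
      ring
    · rw [isogeny_apply, isogenyFun_some_of_ne ht _ hu, some.injEq]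
      refine ⟨by simp, ?_⟩
      rw [eq_zero_of_root ht h.1]
      simp
  · have hw0 : w ≠ 0 := by
      rintro rfl
      exact hx (by linear_combination hw)
    obtain rfl : x = t + w * w := by linear_combination hw
    -- A preimage `(u, v)` may be sought with `v = 2wu`, which leaves `u² - 2(a + 2w²)u + b' = 0`.
    -- Its roots are `2w² + a ± 2y/w`, with product `b'`; the minus sign gives the right
    -- `y`-coordinate.
    have hu : (2 * w ^ 2 + (W.a₂ + 3 * t) - 2 * (y / w)) *
        (2 * w ^ 2 + (W.a₂ + 3 * t) + 2 * (y / w)) =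
        (W.a₂ + 3 * t) ^ 2 - 4 * (3 * t ^ 2 + 2 * W.a₂ * t + W.a₄) := by
      field_simp
      linear_combination -4 * e + 4 * e₀
    have hu0 := left_ne_zero_of_mul (hu ▸ hb')
    have hyw : y = y / w * w := by field_simp
    generalize y / w = z at *
    refine ⟨some (2 * w ^ 2 + (W.a₂ + 3 * t) - 2 * z)
      (2 * w * (2 * w ^ 2 + (W.a₂ + 3 * t) - 2 * z)) (equation_iff_nonsingular.mp (eqn ?_)), ?_⟩
    · rw [← hu]
      ring
    · rw [isogeny_apply, isogenyFun_some_of_ne ht _ hu0, some.injEq]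
      rw [show (W.isogenous t).a₄ = _ from hu.symm, show (4 : K) = 2 ^ 2 by norm_num,
        show (8 : K) = 2 ^ 3 by norm_num]
      generalize hU : 2 * w ^ 2 + (W.a₂ + 3 * t) - 2 * z = u at *
      constructor
      · field_simp
      · rw [hyw]
        field_simp
        linear_combination hU

/-- The half is a preimage of `Q` under the dual isogeny, written out explicitly; the doubling is
checked on a tangent line, without constructing the dual. -/
theorem isogeny_mem_range_nsmul (Q : (W.isogenous t).toAffine.Point)
    (hQ : IsSquare (rootDiff 0 Q)) :
    isogeny ht Q ∈ (nsmulAddMonoidHom (α := W.toAffine.Point) 2).range := by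
  have h2 : (2 : K) ≠ 0 := two_ne_zero
  have e₀ := eq_sq_of_equation ht
  rcases Q with _ | ⟨x, y, h⟩
  · exact zero_mem _
  by_cases hx : x = 0
  · rw [isogeny_apply, isogenyFun_some_of_eq ht h hx]
    exact zero_mem _
  have e := eq_sq_of_equation h.1
  simp only [isogenous, add_zero] at e
  obtain ⟨w, hw⟩ := hQ
  rw [rootDiff_some, if_neg hx, sub_zero] at hw
  subst hw
  have hw0 : w ≠ 0 := left_ne_zero_of_mul hx
  have hyw : y = y / w * w := by field_simp
  have hz : (y / w) ^ 2 = w ^ 4 - 2 * (W.a₂ + 3 * t) * w ^ 2 +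
      ((W.a₂ + 3 * t) ^ 2 - 4 * (3 * t ^ 2 + 2 * W.a₂ * t + W.a₄)) := by
    field_simp
    linear_combination e
  have hψ := isogenyFun_some_of_ne ht h hx
  generalize y / w = z at *
  subst hyw
  -- The dual isogeny has `x`-coordinate `(y/(x - t))²`, so `(t + p, pw)` maps to `x = w²`; lying on
  -- the curve means `p² + (a - w²)p + b = 0`. This root maps to `-Q`, hence the sign in the witness
  -- below.
  obtain ⟨p, hp⟩ : ∃ p, p = (w ^ 2 - (W.a₂ + 3 * t) + z) / 2 := ⟨_, rfl⟩
  have hp' : z = 2 * p - w ^ 2 + (W.a₂ + 3 * t) := by rw [hp]; field_simp; ring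
  have hpw : p * w ^ 2 = p ^ 2 + (W.a₂ + 3 * t) * p + (3 * t ^ 2 + 2 * W.a₂ * t + W.a₄) := by
    rw [hp]
    field_simp
    linear_combination -hz
  have hP : W.toAffine.Nonsingular (t + p) (p * w) := by
    refine equation_iff_nonsingular.mp ((equation_iff ..).mpr ?_)
    have ha₁ : W.toAffine.a₁ = 0 := W.a₁_of_isCharNeTwoNF
    have ha₃ : W.toAffine.a₃ = 0 := W.a₃_of_isCharNeTwoNF
    rw [ha₁, ha₃]
    linear_combination p * hpw + e₀
  refine ⟨-some _ _ hP, ?_⟩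
  rw [nsmulAddMonoidHom_apply, isogeny_apply, hψ, smul_neg, two_nsmul, neg_eq_iff_add_eq_zero]
  -- The tangent at `(t + p, pw)`.
  refine add_add_eq_zero_of_line (l := w + z / (2 * w)) (n := -p * z / (2 * w) -
    (w + z / (2 * w)) * t) h2 _ _ _ ?_ ?_ ?_ ?_ ?_
  · field_simp
    ring
  · field_simp
    ring
  · simp only [isogenous, hp']
    rw [show (4 : K) = 2 ^ 2 by norm_num, show (8 : K) = 2 ^ 3 by norm_num]
    field_simp
    grind
  · rw [hp', show (4 : K) = 2 ^ 2 by norm_num]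
    field_simp
    ring
  · rw [hp', show (4 : K) = 2 ^ 2 by norm_num]
    field_simp
    grind

end Affine.Point
end WeierstrassCurve

/-! ### Heights and finite generation -/

namespace WeierstrassCurve.Affine.Point

section AddSub

variable {K : Type*} [Field K] [DecidableEq K] {W : WeierstrassCurve K}

/-- The duplication formula: the diagonal case, where the chord formulas for `P + Q` and `P - Q`
break down. -/
theorem exists_smul_sym2x_self (P : W.toAffine.Point) :
    ∃ c : K, (fun i ↦ (addSubMap W i).eval (sym2x P P)) = c • sym2x (P + P) 0 := by
  rcases P with _ | ⟨x, y, h⟩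
  · simp only [← zero_def]
    refine ⟨1, ?_⟩
    ext i
    fin_cases i <;> simp [addSubMap]
  have e := (equation_iff ..).mp h.1
  by_cases hy : y = W.toAffine.negY x y
  · rw [add_self_of_Y_eq hy]
    refine ⟨(addSubMap W 0).eval (sym2x (some x y h) (some x y h)), ?_⟩
    rw [sym2x_zero_zero]
    ext i
    fin_cases i
    · simp
    · simp [addSubMap, b₂, b₄, b₆, b₈]
      rw [negY] at hy
      linear_combination -4 * e + (2 * y + W.a₁ * x + W.a₃) * hy
    · simp [addSubMap]
      ring
  · rw [add_self_of_Y_ne hy]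
    have hy' := sub_ne_zero.mpr hy
    rw [sym2x_some_some, sym2x_some_zero, slope_of_Y_ne rfl hy]
    simp only [addX]
    refine ⟨(y - W.toAffine.negY x y) ^ 2, ?_⟩
    ext i
    fin_cases i
    · simp [addSubMap, b₂, b₄, b₆, b₈]
      field_simp
      have hy'' : y - (-y - x * W.a₁ - W.a₃) ≠ 0 := by simpa [negY, mul_comm] using hy'
      field_simp
      grind
    · simp [addSubMap, b₂, b₄, b₆, b₈, negY]
      linear_combination -4 * e
    · simp [addSubMap]
      ring

/-- The map `addSubMap` computes the `x`-coordinates of `P + Q` and `P - Q` up to a scalar. -/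
theorem exists_smul_sym2x_add_sub [W.IsElliptic] (P Q : W.toAffine.Point) :
    ∃ c : K, c ≠ 0 ∧ (fun i ↦ (addSubMap W i).eval (sym2x P Q)) = c • sym2x (P + Q) (P - Q) := by
  -- The scalar is automatically nonzero, as the quadratic forms have no common nontrivial zero on
  -- an elliptic curve.
  suffices H : ∃ c : K,
      (fun i ↦ (addSubMap W i).eval (sym2x P Q)) = c • sym2x (P + Q) (P - Q) by
    obtain ⟨c, hc⟩ := H
    refine ⟨c, ?_, hc⟩
    rintro rfl
    exact addSubMap_ne_zero W (sym2x_ne_zero P Q) (by rw [hc, zero_smul])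
  rcases P with _ | ⟨x₁, y₁, h₁⟩ <;> rcases Q with _ | ⟨x₂, y₂, h₂⟩
  · simp only [← zero_def]
    refine ⟨1, ?_⟩
    ext i
    fin_cases i <;> simp [addSubMap]
  · simp only [← zero_def]
    refine ⟨1, ?_⟩
    ext i
    fin_cases i <;> simp [addSubMap, sym2x] <;> ring
  · simp only [← zero_def]
    refine ⟨1, ?_⟩
    ext i
    fin_cases i <;> simp [addSubMap, sym2x] <;> ring
  have e₁ := (equation_iff ..).mp h₁.1
  have e₂ := (equation_iff ..).mp h₂.1
  rw [sub_eq_add_neg, neg_some]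
  by_cases hx : x₁ = x₂
  · rw [← neg_some, ← sub_eq_add_neg]
    rcases X_eq_iff.mp hx with h | h
    · rw [h, sub_self]
      exact exists_smul_sym2x_self _
    · rw [h, neg_add_cancel, sym2x_comm 0, sym2x_neg_left, ← neg_add', sym2x_neg_left]
      exact exists_smul_sym2x_self _
  · rw [add_of_X_ne hx, add_of_X_ne hx]
    refine ⟨(x₁ - x₂) ^ 2, ?_⟩
    have hx' := sub_ne_zero.mpr hx
    rw [sym2x_some_some, sym2x_some_some, slope_of_X_ne hx, slope_of_X_ne hx]
    simp only [addX, negY]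
    ext i
    fin_cases i
    · simp [addSubMap, b₂, b₄, b₆, b₈]
      field_simp
      grind
    · simp [addSubMap, b₂, b₄, b₆, b₈]
      field_simp
      linear_combination -2 * e₁ - 2 * e₂
    · simp [addSubMap, b₂, b₄, b₆, b₈]
      ring

end AddSub

open Height

variable {K : Type*} [Field K] [DecidableEq K] [AdmissibleAbsValues K] {W : WeierstrassCurve K}

/-- The naive height of a point. -/
noncomputable def naiveHeight (P : W.toAffine.Point) : ℝ := logHeight P.xRep

/-- Up to bounded error, the quadratic map `addSubMap` doubles heights, and the height of `sym2x P
Q` is the sum of the heights of `P` and `Q`. -/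
theorem exists_parallelogram_bound [W.IsElliptic] : ∃ C, ∀ P Q : W.toAffine.Point,
    |naiveHeight (P + Q) + naiveHeight (P - Q) - 2 * (naiveHeight P + naiveHeight Q)| ≤ C := by
  obtain ⟨C₁, h₁⟩ := abs_logHeight_addSubMap_sub_two_mul_logHeight_le W
  obtain ⟨C₂, h₂⟩ := abs_logHeight_sym2_sub_le K
  have h₂' (P Q : W.toAffine.Point) :
      |logHeight (sym2x P Q) - (naiveHeight P + naiveHeight Q)| ≤ C₂ := by
    have eta (P : W.toAffine.Point) : ![P.xRep 0, P.xRep 1] = P.xRep := by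
      ext i; fin_cases i <;> rfl
    have := @h₂ (P.xRep 0) (P.xRep 1) (Q.xRep 0) (Q.xRep 1)
      (by rw [eta]; exact P.xRep_ne_zero) (by rw [eta]; exact Q.xRep_ne_zero)
    rwa [eta, eta] at this
  refine ⟨C₁ + 3 * C₂, fun P Q ↦ ?_⟩
  obtain ⟨c, hc, e⟩ := exists_smul_sym2x_add_sub P Q
  have a₁ := h₁ (sym2x P Q)
  rw [e, logHeight_smul_eq_logHeight _ hc] at a₁
  have a₂ := h₂' P Q
  have a₃ := h₂' (P + Q) (P - Q)
  rw [abs_le] at *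
  constructor <;> linarith [a₁.1, a₁.2, a₂.1, a₂.2, a₃.1, a₃.2]

theorem finite_preimage_xRep (v : Fin 2 → K) : {P : W.toAffine.Point | P.xRep = v}.Finite := by
  by_cases h : ∃ P : W.toAffine.Point, P.xRep = v
  · obtain ⟨P, rfl⟩ := h
    refine (Set.toFinite {P, -P}).subset fun Q hQ ↦ ?_
    simpa using eq_or_eq_neg_of_xRep_eq_xRep hQ
  · convert Set.finite_empty
    ext P
    simpa using fun hP ↦ h ⟨P, hP⟩

instance [Northcott (logHeight₁ (K := K))] : Northcott (naiveHeight (W := W)) where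
  finite_le B := by
    have hfin : ({![1, 0]} ∪ (fun x : K ↦ ![x, 1]) '' {x | logHeight₁ x ≤ B}).Finite :=
      (Set.finite_singleton _).union ((Northcott.finite_le B).image _)
    refine (hfin.biUnion fun v _ ↦ finite_preimage_xRep (W := W) v).subset fun P hP ↦ ?_
    simp only [Set.mem_iUnion, Set.mem_ofPred_eq, exists_prop, exists_eq_right']
    rcases P with _ | ⟨x, y, h⟩
    · left; rfl
    · right
      exact ⟨x, by simpa [logHeight₁_eq_logHeight, naiveHeight] using hP, rfl⟩

theorem fg_of_finiteIndex [W.IsElliptic] [Northcott (logHeight₁ (K := K))]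
    (h : (nsmulAddMonoidHom (α := W.toAffine.Point) 2).range.FiniteIndex) :
    AddGroup.FG W.toAffine.Point := by
  obtain ⟨C, hC⟩ := exists_parallelogram_bound (W := W)
  exact AddCommGroup.fg_of_descent' (h := naiveHeight (W := W)) h (fun P ↦ logHeight_nonneg _) hC

end WeierstrassCurve.Affine.Point

/-! ### Rank and the index of `2G` -/

/-- The rank of a finitely generated abelian group is bounded in terms of the index of `2 G`. -/
theorem two_pow_finrank_le_index (G : Type*) [AddCommGroup G] [Module.Finite ℤ G]
    (h : (nsmulAddMonoidHom (α := G) 2).range.FiniteIndex) :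
    2 ^ Module.finrank ℤ G ≤ (nsmulAddMonoidHom (α := G) 2).range.index := by
  let T := Submodule.torsion ℤ G
  have hT : Module.finrank ℤ (G ⧸ T) = Module.finrank ℤ G :=
    finrank_quotient_eq_of_le_torsion le_rfl
  let b := Module.finBasis ℤ (G ⧸ T)
  -- Coordinates modulo torsion, reduced mod `2`: a surjection onto `(ℤ/2)^r` that kills `2G`.
  let f : G →+ (Fin (Module.finrank ℤ (G ⧸ T)) → ZMod 2) :=
    ((Int.castAddHom (ZMod 2)).compLeft _).comp
      ((b.equivFun.toLinearMap ∘ₗ T.mkQ).toAddMonoidHom)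
  have hf : Function.Surjective f := by
    intro v
    obtain ⟨g, hg⟩ := (b.equivFun.surjective.comp T.mkQ_surjective) fun i ↦ ((v i).val : ℤ)
    refine ⟨g, ?_⟩
    ext i
    change (((b.equivFun (T.mkQ g)) i : ℤ) : ZMod 2) = v i
    rw [show b.equivFun (T.mkQ g) = _ from hg]
    simp
  have hle : (nsmulAddMonoidHom (α := G) 2).range ≤ f.ker := by
    rintro _ ⟨g, rfl⟩
    rw [AddMonoidHom.mem_ker, nsmulAddMonoidHom_apply, map_nsmul]
    ext i
    exact (two_nsmul _).trans (CharTwo.add_self_eq_zero _)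
  calc 2 ^ Module.finrank ℤ G = f.ker.index := by
        rw [AddSubgroup.index_ker, AddMonoidHom.range_eq_top.mpr hf, ← hT]
        simp [Nat.card_eq_fintype_card]
    _ ≤ _ := AddSubgroup.index_antitone hle

theorem rank_le_of_index_le {G : Type*} [AddCommGroup G] [AddGroup.FG G] {n : ℕ}
    (h₀ : (nsmulAddMonoidHom (α := G) 2).range.FiniteIndex)
    (h : (nsmulAddMonoidHom (α := G) 2).range.index ≤ 2 ^ n) :
    Module.rank ℤ G ≤ n := by
  have : Module.Finite ℤ G := Module.Finite.iff_addGroup_fg.mpr inferInstance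
  rw [← Module.finrank_eq_rank, Nat.cast_le]
  exact (Nat.pow_le_pow_iff_right one_lt_two).mp ((two_pow_finrank_le_index G h₀).trans h)

theorem AddMonoidHom.finiteIndex_ker_and_index_le {A B : Type*} [AddCommGroup A] [AddCommGroup B]
    [Finite B] (k : A →+ B) : k.ker.FiniteIndex ∧ k.ker.index ≤ Nat.card B := by
  have hi := AddSubgroup.index_ker k
  refine ⟨⟨by rw [hi]; exact Nat.card_pos.ne'⟩, ?_⟩
  rw [hi]
  exact Nat.card_le_card_of_injective _ Subtype.val_injective

/-- If `ψ : H → G` sends the kernel of `g : H → N` into `2 G` and its range contains the kernel of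
`f : G → M`, then `G / 2 G` is finite, of order at most `|M| |N|`. -/
theorem index_range_nsmul_le {G H M N : Type*} [AddCommGroup G] [AddCommGroup H] [AddCommGroup M]
    [AddCommGroup N] [Finite M] [Finite N] (ψ : H →+ G) (f : G →+ M) (g : H →+ N)
    (hf : f.ker ≤ ψ.range) (hg : g.ker.map ψ ≤ (nsmulAddMonoidHom (α := G) 2).range) :
    (nsmulAddMonoidHom (α := G) 2).range.FiniteIndex ∧
      (nsmulAddMonoidHom (α := G) 2).range.index ≤ Nat.card M * Nat.card N := by
  obtain ⟨_, hf'⟩ := f.finiteIndex_ker_and_index_le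
  obtain ⟨_, hg'⟩ := g.finiteIndex_ker_and_index_le
  have hr := AddSubgroup.finiteIndex_of_le hf
  have hs : (g.ker ⊔ ψ.ker).FiniteIndex := AddSubgroup.finiteIndex_of_le le_sup_left
  -- `[G : ψ(ker g)] = [H : ker g + ker ψ] · [G : ψ(H)]`.
  have hm := AddSubgroup.index_map g.ker ψ
  have : (g.ker.map ψ).FiniteIndex := ⟨by
    rw [hm]; exact mul_ne_zero hs.index_ne_zero hr.index_ne_zero⟩
  refine ⟨AddSubgroup.finiteIndex_of_le hg, (AddSubgroup.index_antitone hg).trans ?_⟩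
  rw [hm, mul_comm]
  exact Nat.mul_le_mul ((AddSubgroup.index_antitone hf).trans hf')
    ((AddSubgroup.index_antitone le_sup_left).trans hg')

/-! ### Rational numbers modulo squares -/

/-- The class of a nonzero rational number modulo squares, seen at the primes in `S` and at the
real place. -/
def signParity (S : Finset ℕ) (x : ℚ) : ZMod 2 × (S → ZMod 2) :=
  (if x < 0 then 1 else 0, fun p ↦ (padicValRat p x : ZMod 2))

theorem signParity_mul {S : Finset ℕ} (hS : ∀ p ∈ S, p.Prime) {x y : ℚ} (hx : x ≠ 0) (hy : y ≠ 0) :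
    signParity S (x * y) = signParity S x + signParity S y := by
  ext p
  · simp only [signParity, Prod.fst_add]
    rcases hx.lt_or_gt with hx | hx <;> rcases hy.lt_or_gt with hy | hy
    · rw [if_neg (mul_pos_of_neg_of_neg hx hy).not_gt, if_pos hx, if_pos hy]; rfl
    · rw [if_pos (mul_neg_of_neg_of_pos hx hy), if_pos hx, if_neg hy.not_gt]; rfl
    · rw [if_pos (mul_neg_of_pos_of_neg hx hy), if_neg hx.not_gt, if_pos hy]; rfl
    · rw [if_neg (mul_pos hx hy).not_gt, if_neg hx.not_gt, if_neg hy.not_gt]; rfl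
  · have : Fact (p : ℕ).Prime := ⟨hS p p.2⟩
    simp [signParity, padicValRat.mul hx hy]

theorem signParity_add_self {S : Finset ℕ} (v : ZMod 2 × (S → ZMod 2)) : v + v = 0 := by
  ext p <;> exact CharTwo.add_self_eq_zero _

theorem Nat.isSquare_of_even_factorization {n : ℕ} (hn : n ≠ 0)
    (h : ∀ p, p.Prime → Even (n.factorization p)) : IsSquare n := by
  rw [← Nat.prod_factorization_pow_eq_self hn]
  exact Finset.isSquare_prod _ fun p hp ↦
    (h p (Nat.prime_of_mem_primeFactors (by simpa using hp))).isSquare_pow _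

theorem Rat.isSquare_of_even_padicValRat {x : ℚ} (hx : 0 < x)
    (h : ∀ p, p.Prime → Even (padicValRat p x)) : IsSquare x := by
  have hd : (x.den : ℚ) ≠ 0 := by exact_mod_cast x.den_nz
  -- Multiplying by the square of the denominator gives a natural number with valuations of the same
  -- parity.
  have hN : ((x.num.natAbs * x.den : ℕ) : ℚ) = x * x.den ^ 2 := by
    push_cast
    have : |(x.num : ℚ)| = x * x.den := by
      rw [Rat.mul_den_eq_num, abs_of_pos]
      exact_mod_cast Rat.num_pos.mpr hx
    rw [Nat.cast_natAbs, Int.cast_abs, this]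
    ring
  have hN0 : x.num.natAbs * x.den ≠ 0 := by
    refine mul_ne_zero ?_ x.den_nz
    simpa using hx.ne'
  obtain ⟨m, hm⟩ := Nat.isSquare_of_even_factorization hN0 fun p hp ↦ by
    have : Fact p.Prime := ⟨hp⟩
    have hv : padicValRat p ((x.num.natAbs * x.den : ℕ) : ℚ) =
        padicValRat p x + 2 * padicValRat p x.den := by
      rw [hN, padicValRat.mul hx.ne' (pow_ne_zero _ hd), sq, padicValRat.mul hd hd, two_mul]
    rw [padicValRat.of_nat] at hv
    rw [Nat.factorization_def _ hp, ← Int.even_coe_nat, hv]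
    exact (h p hp).add (even_two_mul _)
  refine ⟨m / x.den, ?_⟩
  rw [hm] at hN
  push_cast at hN
  field_simp
  linear_combination -hN

theorem isSquare_of_signParity_eq_zero {S : Finset ℕ} {x : ℚ} (hx : x ≠ 0)
    (h : signParity S x = 0) (h' : ∀ p, p.Prime → p ∉ S → Even (padicValRat p x)) :
    IsSquare x := by
  refine Rat.isSquare_of_even_padicValRat ?_ fun p hp ↦ ?_
  · by_contra! hneg
    have := congrArg Prod.fst h
    simp [signParity, lt_of_le_of_ne hneg hx] at this
  · by_cases hpS : p ∈ S
    · have := congrFun (congrArg Prod.snd h) ⟨p, hpS⟩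
      rw [← ZMod.intCast_eq_zero_iff_even]
      exact this
    · exact h' p hp hpS

theorem even_padicValRat_of_padicNorm_eq_sq {p : ℕ} [Fact p.Prime] {z q : ℚ} (hz : z ≠ 0)
    (h : padicNorm p z = padicNorm p q ^ 2) : Even (padicValRat p z) := by
  have hq : q ≠ 0 := by
    rintro rfl
    exact padicNorm.nonzero hz (by simpa using h)
  have hp : (1 : ℚ) < p := by exact_mod_cast (Fact.out : p.Prime).one_lt
  rw [padicNorm.eq_zpow_of_nonzero hz, padicNorm.eq_zpow_of_nonzero hq, ← zpow_natCast,
    ← zpow_mul] at h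
  have := zpow_right_injective₀ (zero_lt_one.trans hp) hp.ne' h
  exact ⟨padicValRat p q, by push_cast at this; linarith⟩

/-- If `z (z² + a z + b)` is a square with `a` integral and `b` prime to `p`, then the valuation of
`z` at `p` is even. -/
theorem even_padicValRat_of_sq_eq {p : ℕ} [Fact p.Prime] {a b : ℤ} (hb : ¬(p : ℤ) ∣ b) {y z : ℚ}
    (hz : z ≠ 0) (h : y ^ 2 = z * (z ^ 2 + a * z + b)) : Even (padicValRat p z) := by
  have hb' := (padicNorm.int_eq_one_iff (p := p) b).mpr hb
  have ha := padicNorm.of_int (p := p) a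
  have hz₀ := padicNorm.nonneg (p := p) z
  have hy : padicNorm p y ^ 2 = padicNorm p z * padicNorm p (z ^ 2 + a * z + b) := by
    rw [← padicNorm.mul, ← h, sq, sq, padicNorm.mul]
  rcases lt_trichotomy (padicNorm p z) 1 with hz₁ | hz₁ | hz₁
  -- If `|z| < 1`, the quadratic factor is a unit because of `b`, so `|z| = |y|²`.
  · have h₁ : padicNorm p (z ^ 2 + a * z) < 1 := by
      rw [show z ^ 2 + a * z = z * z + a * z by ring]
      refine padicNorm.nonarchimedean.trans_lt (max_lt ?_ ?_)
      · rw [padicNorm.mul]; nlinarith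
      · rw [padicNorm.mul]; nlinarith
    have h₂ : padicNorm p (z ^ 2 + a * z + b) = 1 := by
      rw [padicNorm.add_eq_max_of_ne (by rw [hb']; exact h₁.ne), hb', max_eq_right h₁.le]
    rw [h₂, mul_one] at hy
    exact even_padicValRat_of_padicNorm_eq_sq hz hy.symm
  · exact even_padicValRat_of_padicNorm_eq_sq (q := 1) hz (by simpa using hz₁)
  -- If `|z| > 1`, the term `z²` dominates, so `|y|² = |z|³` and `|z| = |y/z|²`.
  · have h₁ : padicNorm p (a * z + b) < padicNorm p (z * z) := by
      refine padicNorm.nonarchimedean.trans_lt (max_lt ?_ ?_)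
      · rw [padicNorm.mul, padicNorm.mul]; nlinarith
      · rw [hb', padicNorm.mul]; nlinarith
    have h₂ : padicNorm p (z ^ 2 + a * z + b) = padicNorm p z ^ 2 := by
      rw [sq z, add_assoc, padicNorm.add_eq_max_of_ne h₁.ne', max_eq_left h₁.le, padicNorm.mul, sq]
    refine even_padicValRat_of_padicNorm_eq_sq (q := y / z) hz ?_
    rw [h₂] at hy
    rw [padicNorm.div, div_pow, hy]
    field_simp

/-! ### The `2`-descent over `ℚ` -/

namespace WeierstrassCurve.Affine.Point

variable {W : WeierstrassCurve ℚ} [W.IsCharNeTwoNF] [W.IsElliptic] {t : ℚ}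

theorem even_padicValRat_rootDiff (ht : W.toAffine.Equation t 0) {a b : ℤ}
    (ha : W.a₂ + 3 * t = a) (hb : 3 * t ^ 2 + 2 * W.a₂ * t + W.a₄ = b) {p : ℕ} [Fact p.Prime]
    (hp : ¬(p : ℤ) ∣ b) (P : W.toAffine.Point) : Even (padicValRat p (rootDiff t P)) := by
  rcases P with _ | ⟨x, y, h⟩
  · rw [← zero_def, rootDiff_zero]
    simp
  rw [rootDiff_some]
  split_ifs with hx
  · rw [hb, padicValRat.of_int, padicValInt.eq_zero_of_not_dvd hp]
    simp
  · refine even_padicValRat_of_sq_eq (a := a) (y := y) hp (sub_ne_zero.mpr hx) ?_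
    have e := eq_sq_of_equation h.1
    have e₀ := eq_sq_of_equation ht
    rw [← ha, ← hb]
    linear_combination e - e₀

/-- The `2`-descent homomorphism attached to a rational `2`-torsion point, modulo squares at the
primes in `S` and at the real place. -/
def descentHom (ht : W.toAffine.Equation t 0) {S : Finset ℕ} (hS : ∀ p ∈ S, p.Prime) :
    W.toAffine.Point →+ ZMod 2 × (S → ZMod 2) :=
  homOfAddAddEqZero (fun P ↦ signParity S (rootDiff t P))
    (fun P ↦ by rw [rootDiff_neg, eq_neg_iff_add_eq_zero, signParity_add_self])
    (fun P Q R h ↦ by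
      have hP := rootDiff_ne_zero ht P
      have hQ := rootDiff_ne_zero ht Q
      have hR := rootDiff_ne_zero ht R
      obtain ⟨r, hr⟩ := isSquare_rootDiff_mul ht P Q R h
      have hr0 : r ≠ 0 := by
        rintro rfl
        simp_all
      rw [← signParity_mul hS hP hQ, ← signParity_mul hS (mul_ne_zero hP hQ) hR, hr,
        signParity_mul hS hr0 hr0, signParity_add_self])

theorem isSquare_rootDiff_of_mem_ker (ht : W.toAffine.Equation t 0) {a b : ℤ}
    (ha : W.a₂ + 3 * t = a) (hb : 3 * t ^ 2 + 2 * W.a₂ * t + W.a₄ = b) {S : Finset ℕ}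
    (hS : ∀ p ∈ S, p.Prime) (hbS : ∀ p : ℕ, p.Prime → (p : ℤ) ∣ b → p ∈ S)
    {P : W.toAffine.Point} (hP : P ∈ (descentHom ht hS).ker) : IsSquare (rootDiff t P) := by
  refine isSquare_of_signParity_eq_zero (S := S) (rootDiff_ne_zero ht P) hP fun p hp hpS ↦ ?_
  have : Fact p.Prime := ⟨hp⟩
  exact even_padicValRat_rootDiff ht ha hb (fun h ↦ hpS (hbS p hp h)) P

/-- The rank of an elliptic curve `y² = (x - t) ((x - t)² + a (x - t) + b)` with `a`, `b` integral
is finite, and bounded in terms of the number of primes dividing `b (a² - 4 b)`. -/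
theorem rank_le (ht : W.toAffine.Equation t 0) {a b : ℤ}
    (ha : W.a₂ + 3 * t = a) (hb : 3 * t ^ 2 + 2 * W.a₂ * t + W.a₄ = b) {S : Finset ℕ}
    (hS : ∀ p ∈ S, p.Prime) (hbS : ∀ p : ℕ, p.Prime → (p : ℤ) ∣ b * (a ^ 2 - 4 * b) → p ∈ S) :
    Module.rank ℤ W.toAffine.Point ≤ (2 * S.card + 2 : ℕ) := by
  have := isElliptic_isogenous ht
  have ht' := isogenous_root W t
  have hker := @isSquare_rootDiff_of_mem_ker _ _ _ _ ht a b ha hb S hS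
    fun p hp h ↦ hbS p hp (h.mul_right _)
  -- On the isogenous curve `b' = a² - 4b`, which is why the primes of both factors must be in `S`.
  have hker' := @isSquare_rootDiff_of_mem_ker _ _ _ _ ht' (-2 * a) (a ^ 2 - 4 * b)
    (by simp [isogenous, ← ha]) (by simp [isogenous, ← ha, ← hb]) S hS
    fun p hp h ↦ hbS p hp (h.mul_left _)
  obtain ⟨hfin, hle⟩ := index_range_nsmul_le (isogeny ht) (descentHom ht hS) (descentHom ht' hS)
    (fun P hP ↦ mem_range_isogeny ht P (hker hP)) (by
      rintro _ ⟨Q, hQ, rfl⟩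
      exact isogeny_mem_range_nsmul ht Q (hker' hQ))
  have := fg_of_finiteIndex hfin
  refine rank_le_of_index_le hfin (hle.trans_eq ?_)
  -- Each target has order `2^(|S| + 1)`, the extra factor `2` being the sign.
  rw [Nat.card_prod, Nat.card_fun, Nat.card_zmod, Nat.card_eq_fintype_card, Fintype.card_coe]
  ring

end WeierstrassCurve.Affine.Point

/-! ### The rank bound for the integral model -/

theorem lemma3p1 (A B : ℤ)
    (hE : ((shortCurve A B).baseChange ℚ).IsElliptic)
    (hmin : IsQuasiMinimal (shortCurve A B))
    (hT : ∃ T : RatPoint (shortCurve A B), addOrderOf T = 2) :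
    Module.rank ℤ (RatPoint (shortCurve A B)) ≤
      ((2 * numPrimeFactors (shortCurve A B).Δ + 2 : ℕ) : Cardinal) := by
  have : ((shortCurve A B).baseChange ℚ).IsCharNeTwoNF :=
    ⟨by simp [shortCurve], by simp [shortCurve]⟩
  have h₂ : ((shortCurve A B).baseChange ℚ).a₂ = 0 := by simp [shortCurve]
  have h₄ : ((shortCurve A B).baseChange ℚ).a₄ = A := by simp [shortCurve]
  have h₆ : ((shortCurve A B).baseChange ℚ).a₆ = B := by simp [shortCurve]
  obtain ⟨T, hT⟩ := hT
  have hT0 : T ≠ 0 := by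
    rintro rfl
    simp at hT
  have hTT : T + T = 0 := by
    rw [← two_nsmul, ← hT, addOrderOf_nsmul_eq_zero]
  rcases T with _ | ⟨x, y, h⟩
  · exact absurd rfl hT0
  have hy : y = 0 := by
    have := eq_neg_of_add_eq_zero_left hTT
    rw [WeierstrassCurve.Affine.Point.neg_some, WeierstrassCurve.Affine.Point.some.injEq] at this
    have := this.2
    simp [WeierstrassCurve.Affine.negY] at this
    linarith
  subst hy
  have e := WeierstrassCurve.Affine.Point.eq_sq_of_equation h.1
  rw [h₂, h₄, h₆] at e
  -- A rational root of a monic integral cubic is an integer.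
  obtain ⟨t, rfl⟩ : ∃ t : ℤ, (t : ℚ) = x := by
    refine IsIntegrallyClosed.isIntegral_iff.mp
      ⟨Polynomial.X ^ 3 + Polynomial.C A * Polynomial.X + Polynomial.C B, by monicity!, ?_⟩
    simp only [Polynomial.eval₂_add, Polynomial.eval₂_mul, Polynomial.eval₂_pow, Polynomial.eval₂_X,
      Polynomial.eval₂_C, algebraMap_int_eq, Int.coe_castRingHom]
    linear_combination -e
  -- This is `16b²(a² - 4b)` with `a = 3t` and `b = 3t² + A`, so the primes dividing `b(a² - 4b)`
  -- divide the discriminant.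
  have hΔ : (shortCurve A B).Δ = 16 * (3 * t ^ 2 + A) ^ 2 * ((3 * t) ^ 2 - 4 * (3 * t ^ 2 + A)) := by
    have : B = -(t ^ 3 + A * t) := by
      have : (B : ℚ) = -(t ^ 3 + A * t) := by linear_combination -e
      exact_mod_cast this
    rw [shortCurve_discr, this]
    ring
  have hΔ0 : (shortCurve A B).Δ ≠ 0 := by
    have := hE.isUnit.ne_zero
    rw [WeierstrassCurve.baseChange, WeierstrassCurve.map_Δ] at this
    rintro h
    simp [h] at this
  refine (WeierstrassCurve.Affine.Point.rank_le h.1 (a := 3 * t) (b := 3 * t ^ 2 + A)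
    (S := (shortCurve A B).Δ.natAbs.primeFactors) (by rw [h₂]; push_cast; ring)
    (by rw [h₂, h₄]; push_cast; ring) (fun p hp ↦ Nat.prime_of_mem_primeFactors hp)
    fun p hp hd ↦ ?_).trans_eq ?_
  · rw [Nat.mem_primeFactors]
    refine ⟨hp, ?_, by simpa using hΔ0⟩
    rw [← Int.natCast_dvd, hΔ]
    exact hd.trans ⟨16 * (3 * t ^ 2 + A), by ring⟩
  · rfl
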